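/- For a permutation $\sigma=\sigma(1)\cdots\sigma(n)$ in the symmetric group $\mathfrak{S}_n$, an occurrence of the pattern 1-3-2 in $\sigma$ is a triple of (not necessarily adjacent) positions $i<j<l$ in $\{1,\dots,n\}$ such that $\sigma(i)<\sigma(l)<\sigma(j)$. For integers $k\ge 0$ and $n\geq 0$ let $\psi_k(n)$ be the number of permutations in $\mathfrak{S}_n$ with at most $k$ occurrences of the pattern 1-3-2. Then for every real constant $C>1$ and every integer $k\ge 0$ we have $$ \psi_k(n) \;\le\; C\,\frac{4^n\, n^{k-\frac32}}{\sqrt{\pi}\,k!} $$ for all sufficiently large $n$ (that is, for all $n\ge n_0$, where $n_0$ may depend on $C$ and $k$). -/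

import Mathlib

/-- The set of occurrences of the (classical) pattern 1-3-2 in a permutation `σ` of `n` letters:
triples of positions `i < j < l`, not necessarily adjacent, with `σ i < σ l < σ j`. -/
def occurrences132 {n : ℕ} (σ : Equiv.Perm (Fin n)) : Finset (Fin n × Fin n × Fin n) :=
  Finset.univ.filter fun t =>
    t.1 < t.2.1 ∧ t.2.1 < t.2.2 ∧ σ t.1 < σ t.2.2 ∧ σ t.2.2 < σ t.2.1

/-- The number `ψ_k(n)` of permutations of `n` letters with at most `k` occurrences of the
pattern 1-3-2. -/
def psi132 (k n : ℕ) : ℕ :=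
  (Finset.univ.filter fun σ : Equiv.Perm (Fin n) => (occurrences132 σ).card ≤ k).card

/-! Let F_k be the generating function of permutations with exactly k occurrences, c the Catalan
series and D = (1 - 4X)^(-1/2). Cut a permutation at its maximum. It is determined by the left value
set and the patterns of the two sides. Besides the occurrences inside each side, every ascent from
left to right gives an occurrence with the maximum as 3. With no ascents the value set is forced and
occurrence counts add exactly. With between 1 and k ascents, the value set differs from the forced
one only near a threshold, leaving at most 4^k choices, and the two sides have fewer than k
occurrences in total (`card_exactAt_le`).

Coefficientwise, F_0 ≼ c, and for k ≥ 1, F_k ≼ X (∑_{a+b=k} F_a F_b + M ∑_{s<k} ∑_{a+b=s} F_a F_b).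
The two terms F_0 F_k are absorbed using (1 - 2Xc)^(-1) = D. Since D² = 4XD² + 1, multiplication by
X costs a factor 1/4, so the leading coefficients obey the Catalan recurrence scaled by 1/4: F_{k+1}
≼ (catalan k / 4^k) D^(2k+1) + O(D^(2k)) (`leadLE_occSeries_succ`). The base F_1 ≼ D needs the sharp
value M = 1; afterwards M only affects lower-order terms.

Coefficient asymptotics of powers of D follow from D' = 2D³ and Wallis' product, without complex
analysis. The constants combine to 1/(√π (k+1)!), and passing from "exactly" to "at most" adds only
terms smaller by a factor of order 1/n. -/

/-! ### Cutting a permutation at its maximum -/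

section PatternSplit

open Finset

/-- The number of permutations of `n` letters with exactly `k` occurrences of 1-3-2. -/
def exact132 (k n : ℕ) : ℕ :=
  (Finset.univ.filter fun σ : Equiv.Perm (Fin n) => (occurrences132 σ).card = k).card

/-- The permutation with the same relative order as the word `f`. -/
noncomputable def standardize {i N : ℕ} (f : Fin i ↪ Fin N) : Equiv.Perm (Fin i) :=
  Equiv.ofBijective
    (fun x => ((univ.map f).orderIsoOfFin (k := i) (by simp)).symm ⟨f x, by simp⟩)
    (Finite.injective_iff_bijective.mp fun x y h => by simpa using h)

theorem orderEmbOfFin_standardize {i N : ℕ} (f : Fin i ↪ Fin N) (x : Fin i) :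
    (univ.map f).orderEmbOfFin (k := i) (by simp) (standardize f x) = f x := by
  simp [standardize, ← Finset.coe_orderIsoOfFin_apply]

theorem standardize_lt_iff {i N : ℕ} (f : Fin i ↪ Fin N) (x y : Fin i) :
    standardize f x < standardize f y ↔ f x < f y := by
  rw [← orderEmbOfFin_standardize f x, ← orderEmbOfFin_standardize f y]
  simp

theorem eq_of_standardize_eq {i N : ℕ} {f g : Fin i ↪ Fin N}
    (hS : univ.map f = univ.map g) (h : standardize f = standardize g) : f = g := by
  ext x
  rw [← orderEmbOfFin_standardize f x, ← orderEmbOfFin_standardize g x, h]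
  simp only [hS]

/-- The embedding of the first `i` positions into `n + 1` positions, where `i + j = n`. -/
def leftPos {i j n : ℕ} (h : i + j = n) : Fin i ↪ Fin (n + 1) :=
  ⟨fun x => ⟨x, by omega⟩, fun x y hxy => by simpa [Fin.ext_iff] using hxy⟩

/-- The embedding of the last `j` positions into `n + 1` positions, where `i + j = n`. -/
def rightPos {i j n : ℕ} (h : i + j = n) : Fin j ↪ Fin (n + 1) :=
  ⟨fun y => ⟨i + 1 + y, by omega⟩, fun x y hxy => by simpa [Fin.ext_iff] using hxy⟩

/-- The position between the first `i` and the last `j` positions. -/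
def midPos {i j n : ℕ} (h : i + j = n) : Fin (n + 1) := ⟨i, by omega⟩

section Split

variable {i j n : ℕ} (h : i + j = n)

theorem pos_cases (x : Fin (n + 1)) :
    (∃ u, x = leftPos h u) ∨ x = midPos h ∨ ∃ v, x = rightPos h v := by
  rcases lt_trichotomy (x : ℕ) i with hx | hx | hx
  · exact Or.inl ⟨⟨x, hx⟩, rfl⟩
  · exact Or.inr (Or.inl (Fin.ext hx))
  · refine Or.inr (Or.inr ⟨⟨x - (i + 1), by omega⟩, Fin.ext ?_⟩)
    change (x : ℕ) = i + 1 + (x - (i + 1))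
    omega

theorem leftPos_lt_iff (u v : Fin i) : leftPos h u < leftPos h v ↔ u < v := Iff.rfl

theorem rightPos_lt_iff (u v : Fin j) : rightPos h u < rightPos h v ↔ u < v :=
  Nat.add_lt_add_iff_left

theorem leftPos_lt_midPos (u : Fin i) : leftPos h u < midPos h := u.2

theorem midPos_lt_rightPos (v : Fin j) : midPos h < rightPos h v := by
  change i < i + 1 + (v : ℕ)
  omega

theorem leftPos_lt_rightPos (u : Fin i) (v : Fin j) : leftPos h u < rightPos h v :=
  (leftPos_lt_midPos h u).trans (midPos_lt_rightPos h v)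

/-- The word to the left of the maximum. -/
def leftWord (σ : Equiv.Perm (Fin (n + 1))) : Fin i ↪ Fin (n + 1) :=
  (leftPos h).trans σ.toEmbedding

/-- The word to the right of the maximum. -/
def rightWord (σ : Equiv.Perm (Fin (n + 1))) : Fin j ↪ Fin (n + 1) :=
  (rightPos h).trans σ.toEmbedding

/-- Pairs of a letter on the left and a larger letter on the right. -/
def ascents (σ : Equiv.Perm (Fin (n + 1))) : Finset (Fin i × Fin j) :=
  univ.filter fun t => leftWord h σ t.1 < rightWord h σ t.2

variable {σ : Equiv.Perm (Fin (n + 1))}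

theorem lt_last_of_ne_midPos (hσ : σ (midPos h) = Fin.last n) {x : Fin (n + 1)}
    (hx : x ≠ midPos h) : σ x < Fin.last n := by
  rw [← hσ]
  refine lt_of_le_of_ne (hσ ▸ Fin.le_last _) fun he => hx (σ.injective he)

theorem leftWord_lt_last (hσ : σ (midPos h) = Fin.last n) (u : Fin i) :
    leftWord h σ u < Fin.last n :=
  lt_last_of_ne_midPos h hσ (leftPos_lt_midPos h u).ne

theorem rightWord_lt_last (hσ : σ (midPos h) = Fin.last n) (v : Fin j) :
    rightWord h σ v < Fin.last n :=
  lt_last_of_ne_midPos h hσ (midPos_lt_rightPos h v).ne'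

theorem leftWord_ne_rightWord (u : Fin i) (v : Fin j) :
    leftWord h σ u ≠ rightWord h σ v := fun he =>
  (leftPos_lt_rightPos h u v).ne (σ.injective he)

theorem mem_occurrences132_standardize {i N : ℕ} (f : Fin i ↪ Fin N) (t : Fin i × Fin i × Fin i) :
    t ∈ occurrences132 (standardize f) ↔
      t.1 < t.2.1 ∧ t.2.1 < t.2.2 ∧ f t.1 < f t.2.2 ∧ f t.2.2 < f t.2.1 := by
  simp [occurrences132, standardize_lt_iff]

/-- Occurrences in the left word, seen as occurrences in the whole permutation. -/
noncomputable def leftOcc (σ : Equiv.Perm (Fin (n + 1))) : Finset (Fin (n + 1) × Fin (n + 1) × Fin (n + 1)) :=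
  (occurrences132 (standardize (leftWord h σ))).map
    ((leftPos h).prodMap ((leftPos h).prodMap (leftPos h)))

/-- Occurrences in the right word, seen as occurrences in the whole permutation. -/
noncomputable def rightOcc (σ : Equiv.Perm (Fin (n + 1))) : Finset (Fin (n + 1) × Fin (n + 1) × Fin (n + 1)) :=
  (occurrences132 (standardize (rightWord h σ))).map
    ((rightPos h).prodMap ((rightPos h).prodMap (rightPos h)))

/-- Occurrences in which the maximum plays the role of the letter 3. -/
def midOcc (σ : Equiv.Perm (Fin (n + 1))) : Finset (Fin (n + 1) × Fin (n + 1) × Fin (n + 1)) :=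
  (ascents h σ).map ⟨fun t => (leftPos h t.1, midPos h, rightPos h t.2), fun s t hst => by
    simp only [Prod.mk.injEq, EmbeddingLike.apply_eq_iff_eq, true_and] at hst
    exact Prod.ext hst.1 hst.2⟩

theorem leftOcc_subset : leftOcc h σ ⊆ occurrences132 σ := by
  intro t ht
  simp only [leftOcc, mem_map, mem_occurrences132_standardize] at ht
  obtain ⟨s, ⟨h1, h2, h3, h4⟩, rfl⟩ := ht
  simp only [occurrences132, mem_filter, mem_univ, true_and]
  exact ⟨(leftPos_lt_iff h _ _).2 h1, (leftPos_lt_iff h _ _).2 h2, h3, h4⟩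

theorem rightOcc_subset : rightOcc h σ ⊆ occurrences132 σ := by
  intro t ht
  simp only [rightOcc, mem_map, mem_occurrences132_standardize] at ht
  obtain ⟨s, ⟨h1, h2, h3, h4⟩, rfl⟩ := ht
  simp only [occurrences132, mem_filter, mem_univ, true_and]
  exact ⟨(rightPos_lt_iff h _ _).2 h1, (rightPos_lt_iff h _ _).2 h2, h3, h4⟩

theorem midOcc_subset (hσ : σ (midPos h) = Fin.last n) : midOcc h σ ⊆ occurrences132 σ := by
  intro t ht
  simp only [midOcc, mem_map, ascents, mem_filter, mem_univ, true_and] at ht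
  obtain ⟨s, hs, rfl⟩ := ht
  simp only [occurrences132, mem_filter, mem_univ, true_and]
  exact ⟨leftPos_lt_midPos h _, midPos_lt_rightPos h _, hs, hσ ▸ rightWord_lt_last h hσ s.2⟩

theorem disjoint_leftOcc_rightOcc : Disjoint (leftOcc h σ) (rightOcc h σ) := by
  rw [Finset.disjoint_left]
  intro t h1 h2
  simp only [leftOcc, rightOcc, mem_map] at h1 h2
  obtain ⟨s, -, rfl⟩ := h1
  obtain ⟨r, -, hr⟩ := h2
  exact (leftPos_lt_rightPos h s.1 r.1).ne' (congrArg Prod.fst hr)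

theorem disjoint_leftOcc_union_rightOcc_midOcc :
    Disjoint (leftOcc h σ ∪ rightOcc h σ) (midOcc h σ) := by
  rw [Finset.disjoint_left]
  intro t h1 h2
  simp only [mem_union, leftOcc, rightOcc, midOcc, mem_map] at h1 h2
  obtain ⟨r, -, rfl⟩ := h2
  rcases h1 with ⟨s, -, hs⟩ | ⟨s, -, hs⟩
  · exact (leftPos_lt_midPos h s.2.1).ne (congrArg (fun t => t.2.1) hs)
  · exact (midPos_lt_rightPos h s.2.1).ne' (congrArg (fun t => t.2.1) hs)

theorem card_occurrences132_split_le (hσ : σ (midPos h) = Fin.last n) :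
    (occurrences132 (standardize (leftWord h σ))).card +
      (occurrences132 (standardize (rightWord h σ))).card + (ascents h σ).card ≤
      (occurrences132 σ).card := by
  have := Finset.card_le_card (Finset.union_subset (Finset.union_subset
    (leftOcc_subset h (σ := σ)) (rightOcc_subset h)) (midOcc_subset h hσ))
  rw [card_union_of_disjoint (disjoint_leftOcc_union_rightOcc_midOcc h),
    card_union_of_disjoint (disjoint_leftOcc_rightOcc h)] at this
  simpa [leftOcc, rightOcc, midOcc] using this

/-- The maximum can only play the 3, and any occurrence using it or straddling it has its 1 on the
left and its 2 on the right, which is an ascent. -/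
theorem card_occurrences132_split_eq (hσ : σ (midPos h) = Fin.last n) (h0 : ascents h σ = ∅) :
    (occurrences132 (standardize (leftWord h σ))).card +
      (occurrences132 (standardize (rightWord h σ))).card = (occurrences132 σ).card := by
  refine le_antisymm ((Nat.le_add_right _ _).trans (card_occurrences132_split_le h hσ)) ?_
  have hno : ∀ u v, ¬ σ (leftPos h u) < σ (rightPos h v) := fun u v hlt => by
    have : (u, v) ∈ ascents h σ := mem_filter.2 ⟨mem_univ _, hlt⟩
    simp [h0] at this
  have hsub : occurrences132 σ ⊆ leftOcc h σ ∪ rightOcc h σ := by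
    rintro ⟨a, b, c⟩ ht
    simp only [occurrences132, mem_filter, mem_univ, true_and] at ht
    obtain ⟨hab, hbc, hac', hcb'⟩ := ht
    have hcm : c ≠ midPos h := by
      rintro rfl
      exact absurd hcb' (hσ ▸ (Fin.le_last _).not_gt)
    have ham : a ≠ midPos h := by
      rintro rfl
      exact absurd hac' (hσ ▸ (Fin.le_last _).not_gt)
    rcases pos_cases h a with ⟨u, rfl⟩ | rfl | ⟨u, rfl⟩
    · rcases pos_cases h c with ⟨v, rfl⟩ | rfl | ⟨v, rfl⟩
      · rcases pos_cases h b with ⟨w, rfl⟩ | rfl | ⟨w, rfl⟩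
        · refine mem_union_left _ (mem_map.2 ⟨(u, w, v), ?_, rfl⟩)
          rw [mem_occurrences132_standardize]
          exact ⟨(leftPos_lt_iff h _ _).1 hab, (leftPos_lt_iff h _ _).1 hbc, hac', hcb'⟩
        · exact absurd hbc (leftPos_lt_midPos h v).not_gt
        · exact absurd hbc (leftPos_lt_rightPos h _ _).not_gt
      · exact absurd rfl hcm
      · exact absurd hac' (hno _ _)
    · exact absurd rfl ham
    · have hc := hab.trans hbc
      rcases pos_cases h c with ⟨v, rfl⟩ | rfl | ⟨v, rfl⟩
      · exact absurd hc (leftPos_lt_rightPos h _ _).not_gt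
      · exact absurd rfl hcm
      · rcases pos_cases h b with ⟨w, rfl⟩ | rfl | ⟨w, rfl⟩
        · exact absurd hab (leftPos_lt_rightPos h _ _).not_gt
        · exact absurd hab (midPos_lt_rightPos h _).not_gt
        · refine mem_union_right _ (mem_map.2 ⟨(u, w, v), ?_, rfl⟩)
          rw [mem_occurrences132_standardize]
          exact ⟨(rightPos_lt_iff h _ _).1 hab, (rightPos_lt_iff h _ _).1 hbc, hac', hcb'⟩
  have := Finset.card_le_card hsub
  rw [card_union_of_disjoint (disjoint_leftOcc_rightOcc h)] at this
  simpa [leftOcc, rightOcc] using this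

/-- The set of letters to the left of the maximum. -/
def leftValues (σ : Equiv.Perm (Fin (n + 1))) : Finset (Fin (n + 1)) := univ.map (leftWord h σ)

/-- Each of the j right letters is either below the left letter `u` or forms an ascent with it. -/
theorem le_val_add_card_ascents (u : Fin i) :
    j ≤ (leftWord h σ u : ℕ) + (ascents h σ).card := by
  have h1 : (univ.filter fun v : Fin j => rightWord h σ v < leftWord h σ u).card ≤
      (leftWord h σ u : ℕ) := by
    rw [← Fin.card_Iio]
    exact card_le_card_of_injOn (rightWord h σ) (fun v hv => by simpa using hv)
      (rightWord h σ).injective.injOn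
  have h2 : (univ.filter fun v : Fin j => ¬ rightWord h σ v < leftWord h σ u).card ≤
      (ascents h σ).card := by
    refine card_le_card_of_injOn (fun v => (u, v)) (fun v hv => ?_) fun v _ w _ hvw => by
      simpa using hvw
    have hv' : leftWord h σ u ≤ rightWord h σ v := by simpa using hv
    simpa [ascents] using lt_of_le_of_ne hv' (leftWord_ne_rightWord h u v)
  have h3 := card_filter_add_card_filter_not (s := (univ : Finset (Fin j)))
    (fun v : Fin j => rightWord h σ v < leftWord h σ u)
  rw [card_univ, Fintype.card_fin] at h3
  omega

/-- Dually, each left letter lies strictly between the right letter `v` and the maximum, or forms an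
ascent with it. -/
theorem val_lt_add_card_ascents (hσ : σ (midPos h) = Fin.last n) (v : Fin j) :
    (rightWord h σ v : ℕ) < j + (ascents h σ).card := by
  have h1 : (univ.filter fun u : Fin i => rightWord h σ v < leftWord h σ u).card ≤
      n - (rightWord h σ v : ℕ) - 1 := by
    have : (Finset.Ioo (rightWord h σ v) (Fin.last n)).card = n - (rightWord h σ v : ℕ) - 1 := by
      simp
    rw [← this]
    exact card_le_card_of_injOn (leftWord h σ)
      (fun u hu => by simpa [leftWord_lt_last h hσ u] using hu)
      (leftWord h σ).injective.injOn
  have h2 : (univ.filter fun u : Fin i => ¬ rightWord h σ v < leftWord h σ u).card ≤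
      (ascents h σ).card := by
    refine card_le_card_of_injOn (fun u => (u, v)) (fun u hu => ?_) fun u _ w _ huw => by
      simpa using huw
    have hu' : leftWord h σ u ≤ rightWord h σ v := by simpa using hu
    simpa [ascents] using lt_of_le_of_ne hu' (leftWord_ne_rightWord h u v)
  have h3 := card_filter_add_card_filter_not (s := (univ : Finset (Fin i)))
    (fun u : Fin i => rightWord h σ v < leftWord h σ u)
  rw [card_univ, Fintype.card_fin] at h3
  have h4 := rightWord_lt_last h hσ v
  rw [Fin.lt_def, Fin.val_last] at h4
  omega

end Split

end PatternSplit

/-! ### Counting value sets and the recursive inequality -/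

section PatternCount

open Finset

/-- Candidate sets of letters to the left of the maximum `n`, when `j` letters are to its right and
at most `k` pairs of letters ascend across it. -/
def leftSets (j n k : ℕ) : Finset (Finset (Fin (n + 1))) :=
  univ.filter fun S =>
    (∀ v ∈ S, j ≤ (v : ℕ) + k ∧ (v : ℕ) < n) ∧ ∀ v ∉ S, (v : ℕ) < n → (v : ℕ) < j + k

/-- The members of `leftSets j n k` for which some pair ascends across the maximum. -/
def ascendingLeftSets (j n k : ℕ) : Finset (Finset (Fin (n + 1))) :=
  (leftSets j n k).filter fun S => ∃ u ∈ S, ∃ v ∉ S, u < v ∧ (v : ℕ) < n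

/-- A member contains every value in [j + k, n) and none below j - k, so its trace on a window of at
most 2k values determines it. -/
theorem card_leftSets_le (j n k : ℕ) : (leftSets j n k).card ≤ 4 ^ k := by
  have h : (leftSets j n k).card ≤ (Finset.Ico (j - k) (j + k)).powerset.card := by
    refine card_le_card_of_injOn
      (fun S => (S.map Fin.valEmbedding).filter fun v => v < j + k) (fun S hS => ?_)
      fun S hS T hT hST => ?_
    · simp only [leftSets, mem_coe, mem_filter, mem_univ, true_and] at hS
      simp only [mem_coe, mem_powerset]
      intro v hv
      simp only [mem_filter, mem_map, Fin.valEmbedding_apply] at hv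
      obtain ⟨⟨w, hw, rfl⟩, hv⟩ := hv
      have := hS.1 w hw
      rw [Finset.mem_Ico]
      omega
    · simp only [leftSets, mem_coe, mem_filter, mem_univ, true_and] at hS hT
      ext v
      by_cases hvk : (v : ℕ) < j + k
      · have := congrArg (fun U : Finset ℕ => (v : ℕ) ∈ U) hST
        simpa [hvk, Fin.val_inj] using this
      · by_cases hvn : (v : ℕ) < n
        · exact ⟨fun _ => by_contra fun h => hvk (hT.2 v h hvn),
            fun _ => by_contra fun h => hvk (hS.2 v h hvn)⟩
        · exact ⟨fun h => absurd (hS.1 v h).2 hvn, fun h => absurd (hT.1 v h).2 hvn⟩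
  refine h.trans ?_
  rw [card_powerset, Nat.card_Ico, show (4 : ℕ) = 2 ^ 2 by norm_num, ← pow_mul]
  exact Nat.pow_le_pow_right (by norm_num) (by omega)

/-- Only the values j - 1 and j are undecided, and an ascent forces the first into the set and the
second out of it. This sharp bound makes the base case F_1 ≼ D possible. -/
theorem card_ascendingLeftSets_one_le (j n : ℕ) : (ascendingLeftSets j n 1).card ≤ 1 := by
  rw [card_le_one]
  have key : ∀ S ∈ ascendingLeftSets j n 1, ∀ v : Fin (n + 1),
      v ∈ S ↔ (v : ℕ) < n ∧ j ≤ (v : ℕ) + 1 ∧ (v : ℕ) ≠ j := by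
    intro S hS v
    simp only [ascendingLeftSets, leftSets, mem_filter, mem_univ, true_and] at hS
    obtain ⟨⟨h1, h2⟩, a, ha, b, hb, hab, hbn⟩ := hS
    have ha' := h1 a ha
    have hb' := h2 b hb hbn
    rw [Fin.lt_def] at hab
    constructor
    · intro hv
      have hv' := h1 v hv
      refine ⟨hv'.2, hv'.1, fun hvj => hb ?_⟩
      rwa [show b = v from Fin.ext (by omega)]
    · rintro ⟨hvn, hv1, hvj⟩
      by_contra hv
      have hv' := h2 v hv hvn
      exact hv (by rwa [show v = a from Fin.ext (by omega)])
  intro S hS T hT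
  ext v
  rw [key S hS, key T hT]

section Count

variable {i j n : ℕ} (h : i + j = n) {σ : Equiv.Perm (Fin (n + 1))}

theorem map_rightWord (hσ : σ (midPos h) = Fin.last n) :
    univ.map (rightWord h σ) = (univ \ leftValues h σ) \ {Fin.last n} := by
  ext v
  simp only [mem_map, mem_univ, true_and, leftValues, mem_sdiff, mem_singleton]
  constructor
  · rintro ⟨y, rfl⟩
    exact ⟨fun ⟨x, hx⟩ => leftWord_ne_rightWord h x y hx, (rightWord_lt_last h hσ y).ne⟩
  · rintro ⟨hl, hm⟩
    obtain ⟨p, rfl⟩ := σ.surjective v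
    rcases pos_cases h p with ⟨u, rfl⟩ | rfl | ⟨u, rfl⟩
    · exact absurd ⟨u, rfl⟩ hl
    · exact absurd hσ hm
    · exact ⟨u, rfl⟩

theorem leftValues_mem_leftSets (hσ : σ (midPos h) = Fin.last n) {k : ℕ}
    (hk : (ascents h σ).card ≤ k) : leftValues h σ ∈ leftSets j n k := by
  simp only [leftSets, mem_filter, mem_univ, true_and]
  constructor
  · intro v hv
    obtain ⟨u, -, rfl⟩ := mem_map.1 hv
    have h1 := le_val_add_card_ascents h (σ := σ) u
    exact ⟨by omega, leftWord_lt_last h hσ u⟩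
  · intro v hv hvn
    have : v ∈ univ.map (rightWord h σ) := by
      rw [map_rightWord h hσ]
      simp only [mem_sdiff, mem_univ, true_and, mem_singleton]
      exact ⟨hv, fun he => by simp [he] at hvn⟩
    obtain ⟨y, -, rfl⟩ := mem_map.1 this
    have := val_lt_add_card_ascents h hσ y
    omega

theorem leftValues_mem_ascendingLeftSets (hσ : σ (midPos h) = Fin.last n) {k : ℕ}
    (hk : (ascents h σ).card ≤ k) (h0 : ascents h σ ≠ ∅) :
    leftValues h σ ∈ ascendingLeftSets j n k := by
  refine mem_filter.2 ⟨leftValues_mem_leftSets h hσ hk, ?_⟩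
  obtain ⟨⟨x, y⟩, hxy⟩ := nonempty_iff_ne_empty.2 h0
  have hxy' : leftWord h σ x < rightWord h σ y := by simpa [ascents] using hxy
  refine ⟨_, mem_map_of_mem _ (mem_univ x), rightWord h σ y, fun hm => ?_, hxy',
    rightWord_lt_last h hσ y⟩
  obtain ⟨u, -, hu⟩ := mem_map.1 hm
  exact leftWord_ne_rightWord h u y hu

/-- The data that determine a permutation with the maximum at a given position. -/
noncomputable def splitAtMax (σ : Equiv.Perm (Fin (n + 1))) :
    Finset (Fin (n + 1)) × Equiv.Perm (Fin i) × Equiv.Perm (Fin j) :=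
  (leftValues h σ, standardize (leftWord h σ), standardize (rightWord h σ))

/-- A word is recovered from its pattern and its value set; the right value set is what the left
values and the maximum leave over. -/
theorem splitAtMax_injOn :
    Set.InjOn (splitAtMax h) {σ | σ (midPos h) = Fin.last n} := by
  intro σ hσ σ' hσ' he
  simp only [splitAtMax, Prod.mk.injEq] at he
  obtain ⟨hS, hl, hr⟩ := he
  have hL : leftWord h σ = leftWord h σ' := eq_of_standardize_eq hS hl
  have hR : rightWord h σ = rightWord h σ' := by
    refine eq_of_standardize_eq ?_ hr
    rw [map_rightWord h hσ, map_rightWord h hσ', hS]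
  ext1 p
  rcases pos_cases h p with ⟨u, rfl⟩ | rfl | ⟨u, rfl⟩
  · exact DFunLike.congr_fun hL u
  · exact hσ.trans hσ'.symm
  · exact DFunLike.congr_fun hR u

/-- Pairs of permutations with `k` occurrences of 1-3-2 in total. -/
def pairs132 (i j k : ℕ) : Finset (Equiv.Perm (Fin i) × Equiv.Perm (Fin j)) :=
  univ.filter fun t => (occurrences132 t.1).card + (occurrences132 t.2).card = k

theorem card_pairs132 (i j k : ℕ) :
    (pairs132 i j k).card = ∑ q ∈ antidiagonal k, exact132 q.1 i * exact132 q.2 j := by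
  rw [card_eq_sum_card_fiberwise (t := antidiagonal k)
    (f := fun t => ((occurrences132 t.1).card, (occurrences132 t.2).card))
    (fun t ht => by simpa [pairs132] using ht)]
  refine sum_congr rfl fun q hq => ?_
  rw [exact132, exact132, ← card_product]
  congr 1
  ext t
  simp only [pairs132, mem_filter, mem_univ, true_and, mem_product, Prod.ext_iff]
  rw [HasAntidiagonal.mem_antidiagonal] at hq
  omega

/-- Permutations with `k` occurrences of 1-3-2 and the maximum at a given position. -/
def exactAt (k : ℕ) : Finset (Equiv.Perm (Fin (n + 1))) :=
  univ.filter fun σ => (occurrences132 σ).card = k ∧ σ (midPos h) = Fin.last n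

theorem card_exactAt_le {k M : ℕ} (hM : (ascendingLeftSets j n k).card ≤ M) :
    (exactAt h k).card ≤
      (pairs132 i j k).card + M * ∑ s ∈ range k, (pairs132 i j s).card := by
  rw [← card_filter_add_card_filter_not (s := exactAt h k) (fun σ => ascents h σ = ∅)]
  refine add_le_add ?_ ?_
  -- No ascents: at most 4^0 = 1 value set, and the occurrences split exactly.
  · have : ((exactAt h k).filter fun σ => ascents h σ = ∅).card ≤
        (leftSets j n 0 ×ˢ pairs132 i j k).card := by
      refine card_le_card_of_injOn (splitAtMax h) (fun σ hσ => ?_)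
        ((splitAtMax_injOn h).mono fun σ hσ => ?_)
      · simp only [exactAt, mem_coe, mem_filter, mem_univ, true_and] at hσ
        obtain ⟨⟨hk, hm⟩, h0⟩ := hσ
        refine mem_product.2 ⟨leftValues_mem_leftSets h hm (by simp [h0]), ?_⟩
        refine mem_filter.2 ⟨mem_univ _, ?_⟩
        rw [← hk]
        exact card_occurrences132_split_eq h hm h0
      · simp only [exactAt, mem_coe, mem_filter, mem_univ, true_and] at hσ
        exact hσ.1.2
    refine this.trans ?_
    rw [card_product]
    exact (Nat.mul_le_mul_right _ (card_leftSets_le j n 0)).trans (by simp)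
  -- At least one occurrence passes through the maximum, so the two sides share fewer than `k`.
  · have : ((exactAt h k).filter fun σ => ¬ ascents h σ = ∅).card ≤
        (ascendingLeftSets j n k ×ˢ (range k).biUnion (pairs132 i j)).card := by
      refine card_le_card_of_injOn (splitAtMax h) (fun σ hσ => ?_)
        ((splitAtMax_injOn h).mono fun σ hσ => ?_)
      · simp only [exactAt, mem_coe, mem_filter, mem_univ, true_and] at hσ
        obtain ⟨⟨hk, hm⟩, h0⟩ := hσ
        have hle := card_occurrences132_split_le h hm
        have hpos := card_pos.2 (nonempty_iff_ne_empty.2 h0)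
        refine mem_product.2 ⟨leftValues_mem_ascendingLeftSets h hm (by omega) h0, ?_⟩
        refine mem_biUnion.2 ⟨_, mem_range.2 ?_, mem_filter.2 ⟨mem_univ _, rfl⟩⟩
        simp only [splitAtMax]
        omega
      · simp only [exactAt, mem_coe, mem_filter, mem_univ, true_and] at hσ
        exact hσ.1.2
    refine this.trans ?_
    rw [card_product]
    exact Nat.mul_le_mul hM card_biUnion_le

end Count

theorem exact132_succ_le {k M : ℕ} (hM : ∀ j n, (ascendingLeftSets j n k).card ≤ M) (n : ℕ) :
    exact132 k (n + 1) ≤ ∑ p ∈ antidiagonal n,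
      (∑ q ∈ antidiagonal k, exact132 q.1 p.1 * exact132 q.2 p.2 +
        M * ∑ s ∈ range k, ∑ q ∈ antidiagonal s, exact132 q.1 p.1 * exact132 q.2 p.2) := by
  rw [exact132, card_eq_sum_card_fiberwise (t := antidiagonal n)
    (f := fun σ => ((σ.symm (Fin.last n) : ℕ), n - (σ.symm (Fin.last n) : ℕ)))
    (fun σ _ => by
      simp only [mem_coe, HasAntidiagonal.mem_antidiagonal]
      omega)]
  refine sum_le_sum fun p hp => ?_
  have hp' := HasAntidiagonal.mem_antidiagonal.1 hp
  simp only [← card_pairs132]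
  refine le_trans (card_le_card fun σ hσ => ?_) (card_exactAt_le hp' (hM p.2 n))
  simp only [mem_filter, mem_univ, true_and] at hσ
  refine mem_filter.2 ⟨mem_univ _, hσ.1, ?_⟩
  rw [← Equiv.eq_symm_apply]
  exact Fin.ext (congrArg Prod.fst hσ.2).symm

theorem exact132_zero_right (k : ℕ) : exact132 k 0 = if k = 0 then 1 else 0 := by
  have : ∀ σ : Equiv.Perm (Fin 0), (occurrences132 σ).card = 0 := fun σ => by
    rw [card_eq_zero]
    ext ⟨a, -⟩
    exact a.elim0
  simp only [exact132, this]
  rcases k with _ | k <;> simp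

theorem psi132_zero_left (n : ℕ) : psi132 0 n = exact132 0 n := by
  simp [psi132, exact132]

theorem psi132_succ (k n : ℕ) : psi132 (k + 1) n = psi132 k n + exact132 (k + 1) n := by
  rw [psi132, psi132, exact132, ← card_union_of_disjoint]
  · congr 1
    ext σ
    simp only [mem_filter, mem_univ, true_and, mem_union]
    omega
  · rw [Finset.disjoint_filter]
    omega

end PatternCount

/-! ### Coefficientwise domination by powers of (1 - 4X)^(-1/2) -/

section CoeffDomination

open PowerSeries

/-- Coefficientwise comparison of real power series. -/
def CoeffLE (f g : ℝ⟦X⟧) : Prop := ∀ n, coeff n f ≤ coeff n g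

infix:50 " ≼ " => CoeffLE

namespace CoeffLE

variable {f g f' g' e : ℝ⟦X⟧}

theorem refl (f : ℝ⟦X⟧) : f ≼ f := fun _ => le_rfl

theorem trans (h : f ≼ g) (h' : g ≼ e) : f ≼ e := fun n => (h n).trans (h' n)

theorem add (h : f ≼ g) (h' : f' ≼ g') : f + f' ≼ g + g' := fun n => by
  simpa using add_le_add (h n) (h' n)

theorem add_nonneg (h : 0 ≼ f) (h' : 0 ≼ g) : 0 ≼ f + g := by simpa using h.add h'

theorem mul (h : f ≼ g) (h' : f' ≼ g') (hf' : 0 ≼ f') (hg : 0 ≼ g) : f * f' ≼ g * g' := fun n => by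
  rw [coeff_mul, coeff_mul]
  exact Finset.sum_le_sum fun p _ =>
    mul_le_mul (h _) (h' _) (by simpa using hf' p.2) (by simpa using hg p.1)

theorem mul_nonneg (h : 0 ≼ f) (h' : 0 ≼ g) : 0 ≼ f * g := by
  simpa using mul h h' (refl 0) h

theorem mul_left (h : f ≼ g) (he : 0 ≼ e) : e * f ≼ e * g := fun n => by
  rw [coeff_mul, coeff_mul]
  exact Finset.sum_le_sum fun p _ => mul_le_mul_of_nonneg_left (h _) (by simpa using he p.1)

theorem mul_right (h : f ≼ g) (he : 0 ≼ e) : f * e ≼ g * e := by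
  simpa only [mul_comm _ e] using h.mul_left he

theorem smul {a : ℝ} (ha : 0 ≤ a) (h : f ≼ g) : a • f ≼ a • g := fun n => by
  simpa using mul_le_mul_of_nonneg_left (h n) ha

theorem smul_nonneg {a : ℝ} (ha : 0 ≤ a) (h : 0 ≼ f) : 0 ≼ a • f := by simpa using smul ha h

theorem smul_le_smul {a b : ℝ} (hab : a ≤ b) (h : 0 ≼ f) : a • f ≼ b • f := fun n => by
  simpa using mul_le_mul_of_nonneg_right hab (by simpa using h n)

theorem zero_one : (0 : ℝ⟦X⟧) ≼ 1 := fun n => by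
  rw [coeff_one]
  split_ifs <;> simp

theorem zero_X : (0 : ℝ⟦X⟧) ≼ X := fun n => by
  rw [coeff_X]
  split_ifs <;> simp

theorem pow_nonneg (h : 0 ≼ f) (n : ℕ) : 0 ≼ f ^ n := by
  induction n with
  | zero => simpa using zero_one
  | succ n ih => rw [pow_succ]; exact mul_nonneg ih h

end CoeffLE

open CoeffLE

/-- The generating function `(1 - 4X)^(-1/2)` of the central binomial coefficients. -/
noncomputable def centralSeries : ℝ⟦X⟧ := mk fun n => (Nat.centralBinom n : ℝ)

/-- The generating function of the Catalan numbers, with real coefficients. -/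
noncomputable def realCatalanSeries : ℝ⟦X⟧ := catalanSeries.map (Nat.castRingHom ℝ)

theorem coeff_centralSeries (n : ℕ) : coeff n centralSeries = Nat.centralBinom n := by
  simp [centralSeries]

theorem coeff_realCatalanSeries (n : ℕ) : coeff n realCatalanSeries = catalan n := by
  simp [realCatalanSeries]

theorem centralSeries_nonneg : 0 ≼ centralSeries := fun n => by
  simp [coeff_centralSeries]

theorem realCatalanSeries_nonneg : 0 ≼ realCatalanSeries := fun n => by
  simp [coeff_realCatalanSeries]

theorem realCatalanSeries_sq_mul_X_add_one :
    realCatalanSeries ^ 2 * X + 1 = realCatalanSeries := by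
  have := congrArg (PowerSeries.map (Nat.castRingHom ℝ)) catalanSeries_sq_mul_X_add_one
  simpa [realCatalanSeries] using this

theorem derivative_centralSeries_mul :
    d⁄dX ℝ centralSeries * (1 - 4 * X) = 2 * centralSeries := by
  have h4 : (4 : ℝ⟦X⟧) = C (4 : ℝ) := (map_ofNat C 4).symm
  have h2 : (2 : ℝ⟦X⟧) = C (2 : ℝ) := (map_ofNat C 2).symm
  have hr : ∀ n : ℕ, (Nat.centralBinom (n + 1) : ℝ) * (n + 1) =
      2 * (2 * n + 1) * Nat.centralBinom n := fun n => by
    have := Nat.succ_mul_centralBinom_succ n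
    rw [mul_comm]
    exact_mod_cast this
  rw [mul_sub, mul_one, h4, h2, mul_left_comm]
  ext n
  rw [map_sub, coeff_C_mul, coeff_C_mul, coeff_derivative, coeff_centralSeries,
    coeff_centralSeries, hr]
  rcases n with _ | n
  · simp
  · rw [coeff_succ_mul_X, coeff_derivative, coeff_centralSeries, hr n, ← hr n]
    push_cast
    ring

/-- The first-order differential equation for D makes the derivative of the left side vanish; the
constant terms agree. -/
theorem centralSeries_sq_mul : centralSeries ^ 2 * (1 - 4 * X) = 1 := by
  refine derivative.ext (R := ℝ) ?_ (by simp [centralSeries])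
  have h4 : d⁄dX ℝ (4 : ℝ⟦X⟧) = 0 := by
    rw [show (4 : ℝ⟦X⟧) = C (4 : ℝ) from (map_ofNat C 4).symm, derivative_C]
  have := derivative_centralSeries_mul
  simp only [Derivation.leibniz, derivative_pow, map_sub, Derivation.map_one_eq_zero, h4,
    derivative_X, smul_eq_mul]
  push_cast
  linear_combination 2 * centralSeries * this

theorem derivative_centralSeries : d⁄dX ℝ centralSeries = 2 * centralSeries ^ 3 := by
  linear_combination centralSeries ^ 2 * derivative_centralSeries_mul -
    d⁄dX ℝ centralSeries * centralSeries_sq_mul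

/-- The Catalan equation gives (1 - 2Xc)² = 1 - 4X, so the product squares to 1; its constant term
selects the sign. -/
theorem centralSeries_mul_one_sub :
    centralSeries * (1 - 2 * X * realCatalanSeries) = 1 := by
  have hsq : (centralSeries * (1 - 2 * X * realCatalanSeries)) ^ 2 = 1 := by
    linear_combination centralSeries_sq_mul +
      centralSeries ^ 2 * 4 * X * realCatalanSeries_sq_mul_X_add_one
  rcases mul_self_eq_one_iff.1 ((sq _).symm.trans hsq) with h | h
  · exact h
  · exact absurd (congrArg constantCoeff h) (by simp [centralSeries]; norm_num)

theorem one_le_centralSeries : 1 ≼ centralSeries := fun n => by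
  rw [coeff_one, coeff_centralSeries]
  split_ifs with h
  · simp [h]
  · positivity

theorem X_le_centralSeries : X ≼ centralSeries := fun n => by
  rw [coeff_X, coeff_centralSeries]
  split_ifs with h
  · simp [h, Nat.centralBinom]
  · positivity

theorem centralSeries_pow_nonneg (p : ℕ) : 0 ≼ centralSeries ^ p :=
  centralSeries_nonneg.pow_nonneg p

theorem centralSeries_pow_le {p q : ℕ} (h : p ≤ q) : centralSeries ^ p ≼ centralSeries ^ q := by
  induction q, h using Nat.le_induction with
  | base => exact refl _
  | succ q _ ih =>
    refine ih.trans ?_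
    simpa [pow_succ] using one_le_centralSeries.mul_left (centralSeries_pow_nonneg q)

theorem X_mul_centralSeries_sq_le : X * centralSeries ^ 2 ≼ (1 / 4 : ℝ) • centralSeries ^ 2 := by
  have h : centralSeries ^ 2 = (4 : ℝ) • (X * centralSeries ^ 2) + 1 := by
    rw [smul_eq_C_mul, show C (4 : ℝ) = (4 : ℝ⟦X⟧) from map_ofNat C 4]
    linear_combination centralSeries_sq_mul
  intro n
  have := congrArg (coeff n) h
  have h1 := zero_one n
  simp only [map_add, coeff_smul, smul_eq_mul, map_zero] at this h1 ⊢
  linarith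

theorem centralSeries_eq_add_one :
    centralSeries = (2 : ℝ) • (X * (centralSeries * realCatalanSeries)) + 1 := by
  rw [smul_eq_C_mul, show C (2 : ℝ) = (2 : ℝ⟦X⟧) from map_ofNat C 2]
  linear_combination centralSeries_mul_one_sub

theorem X_mul_centralSeries_mul_catalan_le :
    X * (centralSeries * realCatalanSeries) ≼ (1 / 2 : ℝ) • centralSeries := by
  intro n
  have := congrArg (coeff n) centralSeries_eq_add_one
  have h1 := zero_one n
  simp only [map_add, coeff_smul, smul_eq_mul, map_zero] at this h1 ⊢
  linarith

theorem centralSeries_mul_catalan_le :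
    centralSeries * realCatalanSeries ≼ (2 : ℝ) • centralSeries := by
  intro n
  have h := congrArg (coeff (n + 1)) centralSeries_eq_add_one
  have hr : (n + 1 : ℝ) * Nat.centralBinom (n + 1) = 2 * (2 * n + 1) * Nat.centralBinom n := by
    exact_mod_cast Nat.succ_mul_centralBinom_succ n
  simp only [map_add, coeff_smul, smul_eq_mul, coeff_succ_X_mul, coeff_one, coeff_centralSeries,
    Nat.add_eq_zero_iff, one_ne_zero, and_false, if_false, add_zero] at h ⊢
  have hc : (0 : ℝ) ≤ Nat.centralBinom n := by positivity
  have hn : (0 : ℝ) < n + 1 := by positivity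
  refine le_of_mul_le_mul_left ?_ hn
  nlinarith

/-- By the Catalan equation the left side is Dc - D, and Dc ≼ 2D. -/
theorem X_mul_centralSeries_mul_catalan_sq_le :
    X * (centralSeries * realCatalanSeries ^ 2) ≼ centralSeries := by
  have h : X * (centralSeries * realCatalanSeries ^ 2) + centralSeries =
      centralSeries * realCatalanSeries := by
    linear_combination centralSeries * realCatalanSeries_sq_mul_X_add_one
  intro n
  have h1 := congrArg (coeff n) h
  have h2 := centralSeries_mul_catalan_le n
  simp only [map_add, coeff_smul, smul_eq_mul] at h1 h2
  linarith

/-- Domination by a leading term `c (1 - 4X)^(-(p+1)/2)` up to a multiple of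
`(1 - 4X)^(-p/2)`. -/
def LeadLE (c : ℝ) (p : ℕ) (f : ℝ⟦X⟧) : Prop :=
  ∃ K : ℝ, 0 ≤ K ∧ f ≼ c • centralSeries ^ (p + 1) + K • centralSeries ^ p

/-- Domination by a multiple of `(1 - 4X)^(-p/2)`. -/
def BigOLE (p : ℕ) (f : ℝ⟦X⟧) : Prop := ∃ K : ℝ, 0 ≤ K ∧ f ≼ K • centralSeries ^ p

namespace BigOLE

variable {p q : ℕ} {f g : ℝ⟦X⟧}

theorem leadLE (h : BigOLE p f) : LeadLE 0 p f := by
  obtain ⟨K, hK, h⟩ := h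
  exact ⟨K, hK, by simpa using h⟩

theorem mono (h : BigOLE p f) (hpq : p ≤ q) : BigOLE q f := by
  obtain ⟨K, hK, h⟩ := h
  exact ⟨K, hK, h.trans (smul hK (centralSeries_pow_le hpq))⟩

theorem mul (hf : BigOLE p f) (hg : BigOLE q g) (hg0 : 0 ≼ g) : BigOLE (p + q) (f * g) := by
  obtain ⟨K, hK, hf⟩ := hf
  obtain ⟨L, hL, hg⟩ := hg
  refine ⟨K * L, _root_.mul_nonneg hK hL, ?_⟩
  have := hf.mul hg hg0 (smul_nonneg hK (centralSeries_pow_nonneg p))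
  rwa [smul_mul_smul_comm, ← pow_add] at this

end BigOLE

namespace LeadLE

variable {c d : ℝ} {p : ℕ} {f g : ℝ⟦X⟧}

theorem of_le (h : LeadLE c p g) (hfg : f ≼ g) : LeadLE c p f := by
  obtain ⟨K, hK, h⟩ := h
  exact ⟨K, hK, hfg.trans h⟩

theorem zero (p : ℕ) : LeadLE 0 p 0 := ⟨0, le_rfl, by simpa using refl 0⟩

theorem add (hf : LeadLE c p f) (hg : LeadLE d p g) : LeadLE (c + d) p (f + g) := by
  obtain ⟨K, hK, hf⟩ := hf
  obtain ⟨L, hL, hg⟩ := hg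
  refine ⟨K + L, _root_.add_nonneg hK hL, ?_⟩
  have := hf.add hg
  rwa [add_add_add_comm, ← add_smul, ← add_smul] at this

theorem smul {a : ℝ} (ha : 0 ≤ a) (hf : LeadLE c p f) : LeadLE (a * c) p (a • f) := by
  obtain ⟨K, hK, hf⟩ := hf
  refine ⟨a * K, _root_.mul_nonneg ha hK, ?_⟩
  have := CoeffLE.smul ha hf
  rwa [smul_add, smul_smul, smul_smul] at this

theorem sum {ι : Type*} {s : Finset ι} {F : ι → ℝ⟦X⟧} {c : ι → ℝ}
    (h : ∀ i ∈ s, LeadLE (c i) p (F i)) : LeadLE (∑ i ∈ s, c i) p (∑ i ∈ s, F i) := by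
  classical
  induction s using Finset.induction_on with
  | empty => simpa using zero p
  | insert a s ha ih =>
    rw [Finset.sum_insert ha, Finset.sum_insert ha]
    exact (h a (Finset.mem_insert_self a s)).add
      (ih fun i hi => h i (Finset.mem_insert_of_mem hi))

theorem bigOLE (hc : 0 ≤ c) (hf : LeadLE c p f) : BigOLE (p + 1) f := by
  obtain ⟨K, hK, hf⟩ := hf
  refine ⟨c + K, _root_.add_nonneg hc hK, hf.trans ?_⟩
  rw [add_smul]
  exact (refl _).add (CoeffLE.smul hK (centralSeries_pow_le (Nat.le_succ p)))

/-- The leading terms multiply under the product that occurs in the recursion. -/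
theorem mul_mul {a b : ℕ} (hc : 0 ≤ c) (hd : 0 ≤ d) (hf : LeadLE c (2 * a) f)
    (hg : LeadLE d (2 * b) g) (hg0 : 0 ≼ g) :
    LeadLE (c * d / 4) (2 * (a + b) + 2) (centralSeries * X * (f * g)) := by
  obtain ⟨K, hK, hf⟩ := hf
  obtain ⟨L, hL, hg⟩ := hg
  have hcd := _root_.mul_nonneg hc hd
  have hDX : 0 ≼ centralSeries * X := centralSeries_nonneg.mul_nonneg zero_X
  have h1 := (hf.mul hg hg0 (add_nonneg (smul_nonneg hc (centralSeries_pow_nonneg _))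
    (smul_nonneg hK (centralSeries_pow_nonneg _)))).mul_left hDX
  -- The leading product: this is where the factor 1/4 in the new constant arises. The cross terms
  -- and the product of remainders are one power lower.
  have hA : X * centralSeries ^ 2 * centralSeries ^ (2 * (a + b) + 1) ≼
      (1 / 4 : ℝ) • centralSeries ^ (2 * (a + b) + 2 + 1) := by
    have := X_mul_centralSeries_sq_le.mul_right (centralSeries_pow_nonneg (2 * (a + b) + 1))
    rw [smul_mul_assoc, ← pow_add] at this
    convert this using 3
    ring
  have hB : X * centralSeries ^ 2 * centralSeries ^ (2 * (a + b)) ≼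
      centralSeries ^ (2 * (a + b) + 2) := by
    have := (X_mul_centralSeries_sq_le.trans (smul_le_smul (by norm_num : (1 / 4 : ℝ) ≤ 1)
      (centralSeries_pow_nonneg 2))).mul_right (centralSeries_pow_nonneg (2 * (a + b)))
    rw [one_smul, ← pow_add] at this
    convert this using 2
    ring
  have hC : X * centralSeries ^ (2 * (a + b) + 1) ≼ centralSeries ^ (2 * (a + b) + 2) := by
    have := X_le_centralSeries.mul_right (centralSeries_pow_nonneg (2 * (a + b) + 1))
    rwa [← pow_succ'] at this
  refine ⟨c * L + K * d + K * L, by positivity, h1.trans ?_⟩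
  have hcL := _root_.mul_nonneg hc hL
  have hKd := _root_.mul_nonneg hK hd
  have hKL := _root_.mul_nonneg hK hL
  have h2 := ((CoeffLE.smul hcd hA).add (CoeffLE.smul (_root_.add_nonneg hcL hKd) hB)).add
    (CoeffLE.smul hKL hC)
  have e1 : centralSeries * X * ((c • centralSeries ^ (2 * a + 1) + K • centralSeries ^ (2 * a)) *
      (d • centralSeries ^ (2 * b + 1) + L • centralSeries ^ (2 * b))) =
      (c * d) • (X * centralSeries ^ 2 * centralSeries ^ (2 * (a + b) + 1)) +
      (c * L + K * d) • (X * centralSeries ^ 2 * centralSeries ^ (2 * (a + b))) +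
      (K * L) • (X * centralSeries ^ (2 * (a + b) + 1)) := by
    simp only [smul_eq_C_mul, map_add, map_mul]
    ring
  have e2 : (c * d) • (1 / 4 : ℝ) • centralSeries ^ (2 * (a + b) + 2 + 1) +
      (c * L + K * d) • centralSeries ^ (2 * (a + b) + 2) +
      (K * L) • centralSeries ^ (2 * (a + b) + 2) =
      (c * d / 4) • centralSeries ^ (2 * (a + b) + 2 + 1) +
      (c * L + K * d + K * L) • centralSeries ^ (2 * (a + b) + 2) := by
    rw [smul_smul, add_assoc, ← add_smul]
    congr 2
    ring
  rw [e1, ← e2]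
  exact h2

end LeadLE

end CoeffDomination

/-! ### Solving the recursion to leading order -/

section OccurrenceSeries

open PowerSeries CoeffLE
open Finset.HasAntidiagonal (antidiagonal)

/-- The generating function of the permutations with exactly `k` occurrences of 1-3-2. -/
noncomputable def occSeries (k : ℕ) : ℝ⟦X⟧ := mk fun n => (exact132 k n : ℝ)

theorem coeff_occSeries (k n : ℕ) : coeff n (occSeries k) = exact132 k n := by simp [occSeries]

theorem occSeries_nonneg (k : ℕ) : 0 ≼ occSeries k := fun n => by simp [coeff_occSeries]

theorem occSeries_le {k M : ℕ} (hk : k ≠ 0) (hM : ∀ j n, (ascendingLeftSets j n k).card ≤ M) :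
    occSeries k ≼ X * (∑ q ∈ antidiagonal k, occSeries q.1 * occSeries q.2 +
      (M : ℝ) • ∑ s ∈ Finset.range k, ∑ q ∈ antidiagonal s,
        occSeries q.1 * occSeries q.2) := by
  intro n
  rcases n with _ | n
  · simp [coeff_occSeries, exact132_zero_right, hk]
  · rw [coeff_succ_X_mul, coeff_occSeries]
    have h := exact132_succ_le hM n
    have h' : (exact132 k (n + 1) : ℝ) ≤ _ := Nat.cast_le.2 h
    refine h'.trans (le_of_eq ?_)
    simp only [map_add, map_sum, coeff_smul, smul_eq_mul, coeff_mul, coeff_occSeries]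
    push_cast
    have hcomm : ∀ s, ∑ p ∈ antidiagonal n, ∑ q ∈ antidiagonal s,
        (exact132 q.1 p.1 * exact132 q.2 p.2 : ℝ) =
        ∑ q ∈ antidiagonal s, ∑ p ∈ antidiagonal n, (exact132 q.1 p.1 * exact132 q.2 p.2 : ℝ) :=
      fun s => Finset.sum_comm
    rw [Finset.sum_add_distrib, hcomm, ← Finset.mul_sum, Finset.sum_comm (t := Finset.range k)]
    simp only [hcomm]

theorem exact132_zero_le_catalan (n : ℕ) : exact132 0 n ≤ catalan n := by
  induction n using Nat.strong_induction_on with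
  | _ n ih =>
    rcases n with _ | n
    · simp [exact132_zero_right]
    -- The bound is immaterial: for `k = 0` it multiplies an empty sum.
    · have hM : ∀ j n, (ascendingLeftSets j n 0).card ≤ 1 := fun j n =>
        (Finset.card_filter_le _ _).trans (card_leftSets_le j n 0)
      refine (exact132_succ_le hM n).trans ?_
      rw [catalan_succ']
      refine Finset.sum_le_sum fun p hp => ?_
      have := Finset.HasAntidiagonal.mem_antidiagonal.1 hp
      simpa using Nat.mul_le_mul (ih p.1 (by omega)) (ih p.2 (by omega))

theorem occSeries_zero_le : occSeries 0 ≼ realCatalanSeries := fun n => by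
  rw [coeff_occSeries, coeff_realCatalanSeries]
  exact_mod_cast exact132_zero_le_catalan n

/-- Replace F_0 by c, move 2Xcf to the left and multiply by D = (1 - 2Xc)^(-1), which preserves the
order as D has nonnegative coefficients. -/
theorem le_of_le_X_mul_add {f r : ℝ⟦X⟧} (hf : 0 ≼ f)
    (h : f ≼ X * (occSeries 0 * f + f * occSeries 0 + r)) : f ≼ centralSeries * X * r := by
  have hC := occSeries_zero_le.mul_right hf
  have hC' := occSeries_zero_le.mul_left hf
  have h1 : f - 2 * X * realCatalanSeries * f ≼ X * r := by
    have h2 := h.trans (((hC.add hC').add (refl r)).mul_left zero_X)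
    have h4 : X * (realCatalanSeries * f + f * realCatalanSeries + r) =
        2 * X * realCatalanSeries * f + X * r := by ring
    rw [h4] at h2
    intro n
    have := h2 n
    simp only [map_add, map_sub] at this ⊢
    linarith
  have h5 := h1.mul_left centralSeries_nonneg
  rwa [show centralSeries * (f - 2 * X * realCatalanSeries * f) = f by
    linear_combination f * centralSeries_mul_one_sub, ← mul_assoc] at h5

theorem occSeries_one_le : occSeries 1 ≼ centralSeries := by
  have h := occSeries_le one_ne_zero card_ascendingLeftSets_one_le
  have h1 : occSeries 1 ≼ centralSeries * X * (occSeries 0 * occSeries 0) := by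
    refine le_of_le_X_mul_add (occSeries_nonneg 1) ?_
    have e : ∑ q ∈ antidiagonal 1, occSeries q.1 * occSeries q.2 =
        occSeries 0 * occSeries 1 + occSeries 1 * occSeries 0 := by
      rw [Finset.Nat.sum_antidiagonal_succ]
      simp
    rw [e] at h
    simpa using h
  refine h1.trans (CoeffLE.trans ?_ X_mul_centralSeries_mul_catalan_sq_le)
  have h2 := (occSeries_zero_le.mul occSeries_zero_le (occSeries_nonneg 0)
    realCatalanSeries_nonneg).mul_left (centralSeries_nonneg.mul_nonneg zero_X)
  rwa [show centralSeries * X * (realCatalanSeries * realCatalanSeries) =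
    X * (centralSeries * realCatalanSeries ^ 2) by ring] at h2

theorem bigOLE_mul_occSeries_zero {f : ℝ⟦X⟧} {p : ℕ} (hf : BigOLE p f) (hf0 : 0 ≼ f) :
    BigOLE (p + 1) (centralSeries * X * (occSeries 0 * f)) := by
  have h := X_mul_centralSeries_mul_catalan_le
  have h0 : centralSeries * X * occSeries 0 ≼ (1 / 2 : ℝ) • centralSeries := by
    refine CoeffLE.trans ?_ h
    have := occSeries_zero_le.mul_left (centralSeries_nonneg.mul_nonneg zero_X)
    rwa [show centralSeries * X * realCatalanSeries =
      X * (centralSeries * realCatalanSeries) by ring] at this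
  have h1 : BigOLE 1 (centralSeries * X * occSeries 0) := ⟨1 / 2, by norm_num, by simpa using h0⟩
  have := h1.mul hf hf0
  rwa [add_comm, mul_assoc] at this

/-- For products with F_0: since DXc ≼ D/2, such a factor raises the order by only one. -/
theorem bigOLE_mul_occSeries {k : ℕ} (a b : ℕ) (hab : a + b ≤ k + 1)
    (ih : ∀ a ≤ k, LeadLE (catalan a / 4 ^ a) (2 * a) (occSeries (a + 1))) :
    BigOLE (2 * k + 2) (centralSeries * X * (occSeries a * occSeries b)) := by
  have hpos : ∀ a, (0 : ℝ) ≤ catalan a / 4 ^ a := fun a => by positivity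
  rcases a with _ | a
  · rcases b with _ | b
    · have hle : centralSeries * X * (occSeries 0 * occSeries 0) ≼ centralSeries := by
        refine CoeffLE.trans ?_ X_mul_centralSeries_mul_catalan_sq_le
        have h2 := (occSeries_zero_le.mul occSeries_zero_le (occSeries_nonneg 0)
          realCatalanSeries_nonneg).mul_left (centralSeries_nonneg.mul_nonneg zero_X)
        rwa [show centralSeries * X * (realCatalanSeries * realCatalanSeries) =
          X * (centralSeries * realCatalanSeries ^ 2) by ring] at h2
      have : BigOLE 1 (centralSeries * X * (occSeries 0 * occSeries 0)) :=
        ⟨1, zero_le_one, by simpa using hle⟩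
      exact this.mono (by omega)
    · exact (bigOLE_mul_occSeries_zero ((ih b (by omega)).bigOLE (hpos b))
        (occSeries_nonneg _)).mono (by omega)
  · rcases b with _ | b
    · rw [mul_comm (occSeries (a + 1))]
      exact (bigOLE_mul_occSeries_zero ((ih a (by omega)).bigOLE (hpos a))
        (occSeries_nonneg _)).mono (by omega)
    · have := (LeadLE.mul_mul (hpos a) (hpos b) (ih a (by omega)) (ih b (by omega))
        (occSeries_nonneg _)).bigOLE (by have := hpos a; have := hpos b; positivity)
      exact this.mono (by omega)

theorem leadLE_occSeries_succ (k : ℕ) :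
    LeadLE (catalan k / 4 ^ k) (2 * k) (occSeries (k + 1)) := by
  induction k using Nat.strong_induction_on with
  | _ k ih =>
    rcases k with _ | k
    · exact ⟨0, le_rfl, by simpa using occSeries_one_le⟩
    · replace ih : ∀ a ≤ k, LeadLE (catalan a / 4 ^ a) (2 * a) (occSeries (a + 1)) :=
        fun a ha => ih a (by omega)
      -- A crude `M` suffices, since it multiplies only lower-order terms.
      have h := occSeries_le (Nat.succ_ne_zero (k + 1)) (M := 4 ^ (k + 2)) fun j n =>
        (Finset.card_filter_le _ _).trans (card_leftSets_le j n (k + 2))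
      have h1 : occSeries (k + 2) ≼ centralSeries * X *
          (∑ q ∈ antidiagonal k, occSeries (q.1 + 1) * occSeries (q.2 + 1) +
          ((4 ^ (k + 2) : ℕ) : ℝ) • ∑ s ∈ Finset.range (k + 2), ∑ q ∈ antidiagonal s,
            occSeries q.1 * occSeries q.2) := by
        refine le_of_le_X_mul_add (occSeries_nonneg _) (h.trans ?_)
        -- Peel off the two end terms, which contain F_0 F_{k+2}.
        rw [Nat.succ_eq_add_one, Finset.Nat.sum_antidiagonal_succ,
          Finset.Nat.sum_antidiagonal_succ', ← add_assoc, add_assoc (_ + _)]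
        exact CoeffLE.refl _
      refine LeadLE.of_le ?_ h1
      rw [mul_add (centralSeries * X), mul_smul_comm, Finset.mul_sum, Finset.mul_sum]
      simp only [Finset.mul_sum]
      have hlow : LeadLE 0 (2 * (k + 1)) (∑ s ∈ Finset.range (k + 2),
          ∑ q ∈ antidiagonal s, centralSeries * X * (occSeries q.1 * occSeries q.2)) := by
        have := LeadLE.sum (s := Finset.range (k + 2)) (c := fun _ => 0) (p := 2 * (k + 1))
          fun s hs => by
            have := LeadLE.sum (s := antidiagonal s) (c := fun _ => 0) (p := 2 * (k + 1))
              (F := fun q => centralSeries * X * (occSeries q.1 * occSeries q.2)) fun q hq => by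
                have h1 := Finset.HasAntidiagonal.mem_antidiagonal.1 hq
                have h2 := Finset.mem_range.1 hs
                exact (bigOLE_mul_occSeries q.1 q.2 (by omega) ih).leadLE
            simpa only [Finset.sum_const_zero] using this
        simpa only [Finset.sum_const_zero] using this
      have hlead := LeadLE.sum (s := antidiagonal k)
        (c := fun q => (catalan q.1 / 4 ^ q.1 : ℝ) * (catalan q.2 / 4 ^ q.2) / 4)
        (p := 2 * (k + 1))
        (F := fun q => centralSeries * X * (occSeries (q.1 + 1) * occSeries (q.2 + 1)))
        fun q hq => by
          have h1 := Finset.HasAntidiagonal.mem_antidiagonal.1 hq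
          have := LeadLE.mul_mul (by positivity) (by positivity) (ih q.1 (by omega))
            (ih q.2 (by omega)) (occSeries_nonneg _)
          rwa [h1] at this
      have := hlead.add (hlow.smul (Nat.cast_nonneg (4 ^ (k + 2))))
      rw [mul_zero, add_zero] at this
      convert this using 1
      -- The leading constants satisfy the Catalan recurrence, scaled by 1/4.
      rw [catalan_succ', Nat.cast_sum, Finset.sum_div]
      refine Finset.sum_congr rfl fun q hq => ?_
      rw [← Finset.HasAntidiagonal.mem_antidiagonal.1 hq]
      push_cast
      field_simp
      ring

end OccurrenceSeries

/-! ### Coefficient asymptotics -/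

section Asymptotics

open PowerSeries CoeffLE Filter Topology

/-- The coefficients of `(1 - 4X)^(-p/2)` divided by `4^n n^(p/2 - 1)`. -/
noncomputable def coeffRatio (p n : ℕ) : ℝ :=
  coeff n (centralSeries ^ p) / (4 ^ n * (n : ℝ) ^ ((p : ℝ) / 2 - 1))

/-- From (D^p)' = 2p D^(p+2), so asymptotics pass from exponent p to p + 2. -/
theorem coeff_centralSeries_pow_add_two (p n : ℕ) :
    2 * p * coeff n (centralSeries ^ (p + 2)) = (n + 1) * coeff (n + 1) (centralSeries ^ p) := by
  rcases p with _ | p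
  · simp [coeff_one]
  have h : d⁄dX ℝ (centralSeries ^ (p + 1)) =
      C (2 * (p + 1 : ℝ)) * centralSeries ^ (p + 1 + 2) := by
    rw [derivative_pow, derivative_centralSeries, map_mul, map_add, map_one, map_natCast,
      map_ofNat]
    simp only [Nat.add_sub_cancel]
    push_cast
    ring
  have := congrArg (coeff n) h
  rw [coeff_derivative, coeff_C_mul] at this
  push_cast
  linarith

theorem coeffRatio_add_two {p n : ℕ} (hp : p ≠ 0) (hn : n ≠ 0) :
    coeffRatio (p + 2) n =
      2 / p * (coeffRatio p (n + 1) * (1 + 1 / (n : ℝ)) ^ ((p : ℝ) / 2)) := by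
  have h := coeff_centralSeries_pow_add_two p n
  have hp' : (0 : ℝ) < p := by positivity
  have hn' : (0 : ℝ) < n := by positivity
  have hn1 : (0 : ℝ) < n + 1 := by positivity
  have h1 : (1 + 1 / (n : ℝ)) ^ ((p : ℝ) / 2) =
      ((n : ℝ) + 1) ^ ((p : ℝ) / 2) / (n : ℝ) ^ ((p : ℝ) / 2) := by
    rw [← Real.div_rpow hn1.le hn'.le]
    congr 1
    field_simp
  have h2 : ((n : ℝ) + 1) ^ ((p : ℝ) / 2) = ((n : ℝ) + 1) ^ ((p : ℝ) / 2 - 1) * (n + 1) := by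
    rw [← Real.rpow_add_one hn1.ne']
    congr 1
    ring
  have h3 : ((p + 2 : ℕ) : ℝ) / 2 - 1 = (p : ℝ) / 2 := by
    push_cast
    ring
  have h4 : coeff n (centralSeries ^ (p + 2)) =
      (n + 1) * coeff (n + 1) (centralSeries ^ p) / (2 * p) := by
    field_simp
    linarith
  have h5 : 0 < (n : ℝ) ^ ((p : ℝ) / 2) := by positivity
  have h6 : 0 < ((n : ℝ) + 1) ^ ((p : ℝ) / 2 - 1) := by positivity
  rw [coeffRatio, coeffRatio, h3, h1, h2, h4, Nat.cast_succ]
  field_simp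
  ring

theorem tendsto_coeffRatio_add_two {p : ℕ} {γ : ℝ} (hp : p ≠ 0)
    (h : Tendsto (coeffRatio p) atTop (𝓝 γ)) :
    Tendsto (coeffRatio (p + 2)) atTop (𝓝 (2 / p * γ)) := by
  have h1 : Tendsto (fun n : ℕ => (1 + 1 / (n : ℝ)) ^ ((p : ℝ) / 2)) atTop (𝓝 1) := by
    have h0 : Tendsto (fun n : ℕ => 1 + 1 / (n : ℝ)) atTop (𝓝 (1 + 0)) :=
      tendsto_const_nhds.add tendsto_one_div_atTop_nhds_zero_nat
    have := h0.rpow_const (p := (p : ℝ) / 2) (Or.inl (by norm_num))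
    simpa using this
  have h2 := ((h.comp (tendsto_add_atTop_nat 1)).mul h1).const_mul (2 / (p : ℝ))
  rw [mul_one] at h2
  refine h2.congr' ?_
  filter_upwards [eventually_ne_atTop 0] with n hn
  exact (coeffRatio_add_two hp hn).symm

theorem wallis_eq_centralBinom (n : ℕ) :
    Real.Wallis.W n = (4 ^ n) ^ 2 / ((Nat.centralBinom n : ℝ) ^ 2 * (2 * n + 1)) := by
  have h : (Nat.centralBinom n : ℝ) * (n.factorial : ℝ) ^ 2 = (2 * n).factorial := by
    have := Nat.choose_mul_factorial_mul_factorial (show n ≤ 2 * n by omega)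
    rw [show 2 * n - n = n by omega, ← Nat.centralBinom_eq_two_mul_choose] at this
    rw [sq, ← mul_assoc]
    exact_mod_cast this
  have h1 : (0 : ℝ) < n.factorial := by positivity
  have h2 : (0 : ℝ) < Nat.centralBinom n := by exact_mod_cast Nat.centralBinom_pos n
  rw [Real.Wallis.W_eq_factorial_ratio, ← h, pow_mul,
    show (2 : ℝ) ^ 4 = 4 ^ 2 by norm_num, ← pow_mul, mul_comm 2 n, pow_mul]
  field_simp

/-- For n ≠ 0 the squared ratio is n/(2n+1) divided by the Wallis product, with limit (1/2)/(π/2).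
-/
theorem tendsto_coeffRatio_one : Tendsto (coeffRatio 1) atTop (𝓝 (1 / √Real.pi)) := by
  have h1 : Tendsto (fun n : ℕ => (n : ℝ) / (2 * n + 1) / Real.Wallis.W n) atTop
      (𝓝 (1 / 2 / (Real.pi / 2))) :=
    Stirling.tendsto_self_div_two_mul_self_add_one.div Real.Wallis.tendsto_W_nhds_pi_div_two
      (by positivity)
  have h2 := (Real.continuous_sqrt.tendsto _).comp h1
  rw [show (1 : ℝ) / 2 / (Real.pi / 2) = 1 / Real.pi by field_simp, Real.sqrt_div zero_le_one,
    Real.sqrt_one] at h2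
  refine h2.congr' ?_
  filter_upwards [eventually_ne_atTop 0] with n hn
  have hn' : (0 : ℝ) < n := by positivity
  have hc : (0 : ℝ) < Nat.centralBinom n := by exact_mod_cast Nat.centralBinom_pos n
  have he : (((1 : ℕ) : ℝ) / 2 - 1) = -(1 / 2) := by norm_num
  have hs : 0 < √(n : ℝ) := Real.sqrt_pos.2 hn'
  rw [Function.comp_apply, wallis_eq_centralBinom, coeffRatio, pow_one, coeff_centralSeries, he,
    Real.rpow_neg hn'.le, ← Real.sqrt_eq_rpow]
  have : (n : ℝ) / (2 * n + 1) / ((4 ^ n) ^ 2 / ((Nat.centralBinom n : ℝ) ^ 2 * (2 * n + 1))) =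
      (Nat.centralBinom n / 4 ^ n) ^ 2 * n := by
    field_simp
  rw [this, Real.sqrt_mul (by positivity), Real.sqrt_sq (by positivity)]
  field_simp

theorem tendsto_coeffRatio_odd (k : ℕ) : Tendsto (coeffRatio (2 * k + 1)) atTop
    (𝓝 (4 ^ k * k.factorial / ((2 * k).factorial * √Real.pi))) := by
  induction k with
  | zero => simpa using tendsto_coeffRatio_one
  | succ k ih =>
    have hpi : 0 < √Real.pi := Real.sqrt_pos.2 Real.pi_pos
    have hv : (4 ^ (k + 1) * (k + 1).factorial / ((2 * (k + 1)).factorial * √Real.pi) : ℝ) =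
        2 / ((2 * k + 1 : ℕ) : ℝ) *
          (4 ^ k * k.factorial / ((2 * k).factorial * √Real.pi)) := by
      rw [mul_add, mul_one, Nat.factorial_succ (2 * k + 1), Nat.factorial_succ,
        Nat.factorial_succ]
      push_cast
      field_simp
      ring
    rw [hv]
    exact tendsto_coeffRatio_add_two (Nat.succ_ne_zero (2 * k)) ih

theorem tendsto_coeffRatio_zero : Tendsto (coeffRatio 0) atTop (𝓝 0) := by
  refine tendsto_const_nhds.congr' ?_
  filter_upwards [eventually_ne_atTop 0] with n hn
  simp [coeffRatio, coeff_one, hn]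

theorem coeff_centralSeries_sq (n : ℕ) : coeff n (centralSeries ^ 2) = 4 ^ n := by
  have h : centralSeries ^ 2 = C (4 : ℝ) * (X * centralSeries ^ 2) + 1 := by
    rw [map_ofNat]
    linear_combination centralSeries_sq_mul
  induction n with
  | zero => simp [centralSeries]
  | succ n ih =>
    rw [h, map_add, coeff_C_mul, coeff_succ_X_mul, ih, coeff_one]
    simp [pow_succ']

/-- Even powers occur only in the remainder, so any finite limit will do. -/
theorem exists_tendsto_coeffRatio_even (k : ℕ) :
    ∃ γ, Tendsto (coeffRatio (2 * k)) atTop (𝓝 γ) := by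
  -- Exponent 0 is separate because the recursion divides by it; the induction starts at D² = 1/(1 -
  -- 4X).
  rcases k with _ | k
  · exact ⟨0, tendsto_coeffRatio_zero⟩
  induction k with
  | zero =>
    refine ⟨1, tendsto_const_nhds.congr fun n => ?_⟩
    rw [coeffRatio, zero_add, mul_one, coeff_centralSeries_sq]
    norm_num
  | succ k ih =>
    obtain ⟨γ, h⟩ := ih
    exact ⟨_, tendsto_coeffRatio_add_two (Nat.mul_ne_zero two_ne_zero k.succ_ne_zero) h⟩

/-- The number of permutations is asymptotically at most `γ 4^n n^(k - 3/2)`. -/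
def AsympLE (f : ℕ → ℕ) (k : ℕ) (γ : ℝ) : Prop :=
  ∃ g : ℕ → ℝ, Tendsto g atTop (𝓝 γ) ∧
    ∀ᶠ n : ℕ in atTop, (f n : ℝ) ≤ g n * (4 ^ n * (n : ℝ) ^ ((k : ℝ) - 3 / 2))

theorem asympLE_exact132_zero : AsympLE (exact132 0) 0 (1 / √Real.pi) := by
  have h : Tendsto (fun n : ℕ => (n : ℝ) / (n + 1) * coeffRatio 1 n) atTop
      (𝓝 (1 * (1 / √Real.pi))) :=
    (tendsto_natCast_div_add_atTop (1 : ℝ)).mul tendsto_coeffRatio_one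
  rw [one_mul] at h
  refine ⟨_, h, ?_⟩
  filter_upwards [eventually_ne_atTop 0] with n hn
  have hn' : (0 : ℝ) < n := by positivity
  have h1 : (exact132 0 n : ℝ) ≤ catalan n := by exact_mod_cast exact132_zero_le_catalan n
  refine h1.trans (le_of_eq ?_)
  have h2 : ((n : ℝ) + 1) * catalan n = Nat.centralBinom n := by
    exact_mod_cast succ_mul_catalan_eq_centralBinom n
  have h3 : (n : ℝ) ^ (((1 : ℕ) : ℝ) / 2 - 1) = (n : ℝ) ^ (((0 : ℕ) : ℝ) - 3 / 2) * n := by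
    rw [← Real.rpow_add_one hn'.ne']
    norm_num
  have h4 : 0 < (n : ℝ) ^ (((0 : ℕ) : ℝ) - 3 / 2) := by positivity
  rw [coeffRatio, pow_one, coeff_centralSeries, ← h2, h3]
  field_simp

theorem asympLE_exact132_succ (k : ℕ) :
    AsympLE (exact132 (k + 1)) (k + 1) (1 / (√Real.pi * (k + 1).factorial)) := by
  obtain ⟨K, hK, hle⟩ := leadLE_occSeries_succ k
  obtain ⟨γ, hγ⟩ := exists_tendsto_coeffRatio_even k
  -- Lowering the power of D by one costs n^(-1/2), which kills the remainder.
  have hinv : Tendsto (fun n : ℕ => (n : ℝ) ^ (-(1 / 2) : ℝ)) atTop (𝓝 0) :=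
    (tendsto_rpow_neg_atTop (by norm_num : (0 : ℝ) < 1 / 2)).comp tendsto_natCast_atTop_atTop
  have h := ((tendsto_coeffRatio_odd k).const_mul (catalan k / 4 ^ k : ℝ)).add
    ((hγ.mul hinv).const_mul K)
  have hpi : 0 < √Real.pi := Real.sqrt_pos.2 Real.pi_pos
  have hval : (catalan k / 4 ^ k : ℝ) * (4 ^ k * k.factorial / ((2 * k).factorial * √Real.pi)) +
      K * (γ * 0) = 1 / (√Real.pi * (k + 1).factorial) := by
    have h1 : ((k : ℝ) + 1) * catalan k * (k.factorial : ℝ) ^ 2 = (2 * k).factorial := by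
      have h2 : ((k : ℝ) + 1) * catalan k = Nat.centralBinom k := by
        exact_mod_cast succ_mul_catalan_eq_centralBinom k
      have := Nat.choose_mul_factorial_mul_factorial (show k ≤ 2 * k by omega)
      rw [show 2 * k - k = k by omega, ← Nat.centralBinom_eq_two_mul_choose] at this
      rw [h2, sq, ← mul_assoc]
      exact_mod_cast this
    have hk : (0 : ℝ) < k.factorial := by positivity
    rw [Nat.factorial_succ]
    push_cast
    field_simp
    rw [← h1]
    ring
  rw [hval] at h
  refine ⟨_, h, ?_⟩
  filter_upwards [eventually_ne_atTop 0] with n hn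
  have hn' : (0 : ℝ) < n := by positivity
  have h1 := hle n
  rw [coeff_occSeries, map_add, coeff_smul, coeff_smul, smul_eq_mul, smul_eq_mul] at h1
  refine h1.trans (le_of_eq ?_)
  have e1 : ((2 * k + 1 : ℕ) : ℝ) / 2 - 1 = ((k + 1 : ℕ) : ℝ) - 3 / 2 := by
    push_cast
    ring
  have e2 : (n : ℝ) ^ (((k + 1 : ℕ) : ℝ) - 3 / 2) =
      (n : ℝ) ^ (((2 * k : ℕ) : ℝ) / 2 - 1) * (n : ℝ) ^ (1 / 2 : ℝ) := by
    rw [← Real.rpow_add hn']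
    congr 1
    push_cast
    ring
  have p1 : 0 < (n : ℝ) ^ (((2 * k : ℕ) : ℝ) / 2 - 1) := by positivity
  have p2 : 0 < (n : ℝ) ^ (1 / 2 : ℝ) := by positivity
  rw [coeffRatio, coeffRatio, e1, Real.rpow_neg hn'.le, e2]
  field_simp

theorem asympLE_psi132 (k : ℕ) : AsympLE (psi132 k) k (1 / (√Real.pi * k.factorial)) := by
  induction k with
  | zero =>
    obtain ⟨g, hg, hle⟩ := asympLE_exact132_zero
    refine ⟨g, by simpa using hg, ?_⟩
    simpa only [psi132_zero_left] using hle
  | succ k ih =>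
    obtain ⟨g, hg, hle⟩ := ih
    obtain ⟨g', hg', hle'⟩ := asympLE_exact132_succ k
    -- Relative to the new scale, the bound for at most `k` occurrences carries a factor 1/n.
    have h := (hg.mul tendsto_one_div_atTop_nhds_zero_nat).add hg'
    rw [mul_zero, zero_add] at h
    refine ⟨_, h, ?_⟩
    filter_upwards [hle, hle', eventually_ne_atTop 0] with n h1 h2 hn
    have hn' : (0 : ℝ) < n := by positivity
    have e : (n : ℝ) ^ (((k + 1 : ℕ) : ℝ) - 3 / 2) = (n : ℝ) ^ ((k : ℝ) - 3 / 2) * n := by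
      rw [← Real.rpow_add_one hn'.ne']
      congr 1
      push_cast
      ring
    rw [psi132_succ, Nat.cast_add, add_mul]
    refine add_le_add (h1.trans (le_of_eq ?_)) h2
    rw [e]
    field_simp

end Asymptotics

theorem mainTheorem4 (C : ℝ) (hC : 1 < C) (k : ℕ) :
    ∀ᶠ n : ℕ in Filter.atTop,
      (psi132 k n : ℝ) ≤
        C * (((4 : ℝ) ^ n * (n : ℝ) ^ ((k : ℝ) - 3 / 2)) /
          (Real.sqrt Real.pi * (Nat.factorial k : ℝ))) := by
  obtain ⟨g, hg, hle⟩ := asympLE_psi132 k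
  have hpos : 0 < Real.sqrt Real.pi * (k.factorial : ℝ) :=
    mul_pos (Real.sqrt_pos.2 Real.pi_pos) (by positivity)
  have hlt : 1 / (Real.sqrt Real.pi * (k.factorial : ℝ)) <
      C * (1 / (Real.sqrt Real.pi * (k.factorial : ℝ))) :=
    lt_mul_of_one_lt_left (by positivity) hC
  filter_upwards [hle, hg.eventually_lt_const hlt] with n h1 h2
  refine h1.trans ((mul_le_mul_of_nonneg_right h2.le (by positivity)).trans (le_of_eq ?_))
  ring
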